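/- Let $G=\mathbb Z_{13}\rtimes\mathbb Z_6=\langle X,Y : X^{13}=Y^6=1,\ YX=X^4Y\rangle$ (SmallGroup(78,1)), and for $F=\sum_{g\in G}a_g g$ in the integral group ring $\mathbb Z[G]$ let $D(F)=\det\left(a_{gh^{-1}}\right)_{g,h\in G}$ be its group determinant. Then the set of values $\{D(F): F\in\mathbb Z[G]\}$ consists exactly of the integers of the form $$ m\,N\!\left(m+13\alpha+\tfrac12(13+\sqrt{13})\beta\right)^6,\qquad m,\alpha,\beta\in\mathbb Z,\quad (m \text{ odd or } 4\mid m),\quad (3\nmid m \text{ or } 9\mid m), $$ where $N$ denotes the norm from $\mathbb Q(\sqrt{13})$ to $\mathbb Q$. -/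

import Mathlib

open scoped IntermediateField

/-- The group determinant `D(∑ a_g g) = det (a_{g h⁻¹})` of an element of the integral group ring
`ℤ[G]` of a finite group `G`; rows are indexed by `g` and columns by `h`. -/
def groupDeterminant {G : Type*} [Group G] [Fintype G] [DecidableEq G]
    (F : MonoidAlgebra ℤ G) : ℤ :=
  Matrix.det (Matrix.of fun g h : G => F.coeff (g * h⁻¹))

/-- The action of `ℤ/6` on `ℤ/13` (both written multiplicatively) in which `j` acts as
multiplication by `4 ^ j`; the class of `4` has order `6` modulo `13`, with inverse `10`. -/
def actionFour : Multiplicative (ZMod 6) →* MulAut (Multiplicative (ZMod 13)) where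
  toFun j :=
    { toFun := fun x => Multiplicative.ofAdd ((4 : ZMod 13) ^ j.toAdd.val * x.toAdd)
      invFun := fun x => Multiplicative.ofAdd ((10 : ZMod 13) ^ j.toAdd.val * x.toAdd)
      left_inv := by revert j; decide
      right_inv := by revert j; decide
      map_mul' := fun x y => by
        rw [toAdd_mul, mul_add, ofAdd_add] }
  map_one' := by decide
  map_mul' := by decide

/-- The group `ℤ₁₃ ⋊ ℤ₆ = ⟨X, Y : X ^ 13 = Y ^ 6 = 1, Y X = X ^ 4 Y⟩`. -/
abbrev Z13Z6 : Type :=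
  Multiplicative (ZMod 13) ⋊[actionFour] Multiplicative (ZMod 6)

instance : Fintype Z13Z6 :=
  Fintype.ofEquiv (Multiplicative (ZMod 13) × Multiplicative (ZMod 6))
    SemidirectProduct.equivProd.symm

/-- The generator `X` of order `13`. -/
def genX : Z13Z6 := SemidirectProduct.inl (Multiplicative.ofAdd 1)

/-- The generator `Y` of order `6`. -/
def genY : Z13Z6 := SemidirectProduct.inr (Multiplicative.ofAdd 1)

/-- The order of the group, the defining relations, and the fact that `X` and `Y` generate. -/
theorem z13z6_presentation :
    Fintype.card Z13Z6 = 78 ∧ genX ^ 13 = 1 ∧ genY ^ 6 = 1 ∧ genY * genX = genX ^ 4 * genY ∧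
      ∀ g : Z13Z6, ∃ (i : Fin 13) (j : Fin 6), g = genX ^ (i : ℕ) * genY ^ (j : ℕ) := by
  refine ⟨by rw [Fintype.ofEquiv_card]; rfl, by decide, by decide, by decide, ?_⟩
  rintro ⟨x, y⟩
  revert x y
  decide

/-- The real quadratic field `ℚ(√13)`. -/
abbrev QSqrt13 : Type := ℚ⟮Real.sqrt 13⟯

/-- The element `√13` of `ℚ(√13)`. -/
noncomputable def sqrt13 : QSqrt13 := IntermediateField.AdjoinSimple.gen ℚ (Real.sqrt 13)

/-! The regular representation is the sum of the thirteen representations induced from the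
characters of ⟨X⟩, so D(F) is a product of thirteen 6 × 6 determinants (`cast_groupDeterminant`).
Each is invariant under X ↦ X⁴, and 4 generates the squares modulo 13, so each has the form t₀ + t₁S
+ t₂N, with S and N the character sums over squares and nonsquares (`exists_det_inducedMatrix`). The
trivial character contributes m = t₀ + 6t₁ + 6t₂; the other twelve contribute the sixth power of a
norm from ℚ(√13). Since m is also a circulant determinant of order six, 2 ∣ m forces 4 ∣ m and 3 ∣ m
forces 9 ∣ m (`det_circulant_six_dvd`).

Conversely, every triple t₀, t₁, t₂ with admissible m is realised. With σ = 1 + Y + ⋯ + Y⁵, the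
element a(Y) + x(X)σy(X) + w(X)σ induces a circulant plus a matrix of rank at most two, and its
determinant is affine in w (`mul_det_perturbedCoeff`). If a has augmentation c and circulant
determinant c², the trivial character gives c² + 6ck, so m ≡ c² modulo 6c. For c = 1, 2, 3, 6
suitable x and y let w reach every period with such m (`isAttainable_of_perturbationForm`). Up to
sign these four classes exhaust the admissible m. -/

/-! ### Splitting the group determinant into induced representations. -/

/-- The power `4 ^ l` in `ℤ/13`, for an exponent `l` in `ℤ/6`. -/
def fourPow (l : ZMod 6) : ZMod 13 := 4 ^ l.val

theorem fourPow_add (i j : ZMod 6) : fourPow (i + j) = fourPow i * fourPow j := by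
  revert i j; decide

theorem fourPow_zero : fourPow 0 = 1 := rfl

theorem fourPow_neg_mul (l : ZMod 6) : fourPow (-l) * fourPow l = 1 := by
  rw [← fourPow_add, neg_add_cancel, fourPow_zero]

theorem fourPow_mul_neg (l : ZMod 6) : fourPow l * fourPow (-l) = 1 := by
  rw [mul_comm, fourPow_neg_mul]

/-- The element `X ^ x * Y ^ l` of the group. -/
def monomialElt (x : ZMod 13) (l : ZMod 6) : Z13Z6 :=
  ⟨Multiplicative.ofAdd x, Multiplicative.ofAdd l⟩

/-- Elements of the group are monomials `X ^ x * Y ^ l`. -/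
def monomialEquiv : ZMod 6 × ZMod 13 ≃ Z13Z6 where
  toFun p := monomialElt p.2 p.1
  invFun g := (g.right.toAdd, g.left.toAdd)
  left_inv _ := rfl
  right_inv _ := rfl

theorem monomialElt_mul_inv (x y : ZMod 13) (l j : ZMod 6) :
    monomialElt x l * (monomialElt y j)⁻¹ = monomialElt (x - fourPow (l - j) * y) (l - j) := by
  have h : ∀ (i : ZMod 6) (z : ZMod 13), actionFour (Multiplicative.ofAdd i)
      (Multiplicative.ofAdd z) = Multiplicative.ofAdd (fourPow i * z) := fun _ _ => rfl
  have h1 : (monomialElt y j)⁻¹ = monomialElt (fourPow (-j) * (-y)) (-j) := rfl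
  have h2 : monomialElt x l * monomialElt (fourPow (-j) * (-y)) (-j) =
    monomialElt (x + fourPow l * (fourPow (-j) * (-y))) (l + -j) := rfl
  rw [h1, h2, sub_eq_add_neg l j, fourPow_add]
  congr 1
  ring

/-- The coefficient of `X ^ x * Y ^ l`, as a function of `l` and `x`. -/
def monomialCoeff (F : MonoidAlgebra ℤ Z13Z6) (l : ZMod 6) (x : ZMod 13) : ℤ :=
  F.coeff (monomialElt x l)

/-- The matrix of the element `∑ f l x X ^ x Y ^ l` in the representation of the group induced by
the character `ψ` of the subgroup generated by `X`. -/
def inducedMatrix {R : Type*} [CommRing R] (f : ZMod 6 → ZMod 13 → ℤ) (ψ : ZMod 13 → R) :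
    Matrix (ZMod 6) (ZMod 6) R :=
  Matrix.of fun l j => ∑ t, (f (l - j) t : R) * ψ (fourPow (-l) * t)

theorem groupDeterminant_eq_det (F : MonoidAlgebra ℤ Z13Z6) :
    groupDeterminant F = Matrix.det (Matrix.of fun p q : ZMod 6 × ZMod 13 =>
      monomialCoeff F (p.1 - q.1) (p.2 - fourPow (p.1 - q.1) * q.2)) := by
  rw [groupDeterminant, ← Matrix.det_submatrix_equiv_self monomialEquiv]
  congr 1
  ext p q
  exact congrArg F.coeff (monomialElt_mul_inv _ _ _ _)

theorem sum_addChar_mul {K : Type*} [Field K] {ψ : AddChar (ZMod 13) K} (hψ : ψ.IsPrimitive)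
    (b : ZMod 13) : ∑ x, ψ (x * b) = if b = 0 then 13 else 0 := by
  rw [AddChar.sum_mulShift b hψ, ZMod.card]
  split_ifs <;> simp

/-- The group determinant is the product of the determinants of the representations induced by
the powers of a primitive character of the subgroup generated by `X`. -/
theorem cast_groupDeterminant {K : Type*} [Field K] [CharZero K] {ψ : AddChar (ZMod 13) K}
    (hψ : ψ.IsPrimitive) (F : MonoidAlgebra ℤ Z13Z6) :
    (groupDeterminant F : K) =
      ∏ χ : ZMod 13, (inducedMatrix (monomialCoeff F) (ψ.mulShift χ)).det := by
  set f := monomialCoeff F with hf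
  let A : Matrix (ZMod 6 × ZMod 13) (ZMod 6 × ZMod 13) K := Matrix.of fun p q =>
    (f (p.1 - q.1) (p.2 - fourPow (p.1 - q.1) * q.2) : K)
  -- A Fourier matrix on each coset of ⟨X⟩, twisted by the action of Y. Its multiple `Q` of the
  -- inverse serves only to show that `P` is invertible.
  let P : Matrix (ZMod 6 × ZMod 13) (ZMod 6 × ZMod 13) K := Matrix.of fun p q =>
    if p.1 = q.1 then ψ (-(q.2 * (fourPow (-p.1) * p.2))) else 0
  let Q : Matrix (ZMod 6 × ZMod 13) (ZMod 6 × ZMod 13) K := Matrix.of fun p q =>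
    if p.1 = q.1 then ψ (p.2 * (fourPow (-q.1) * q.2)) else 0
  have hA : (groupDeterminant F : K) = A.det := by
    rw [groupDeterminant_eq_det, Int.cast_det]
    rfl
  have hPQ : P * Q = (13 : K) • (1 : Matrix (ZMod 6 × ZMod 13) (ZMod 6 × ZMod 13) K) := by
    ext ⟨l, x⟩ ⟨j, y⟩
    simp only [Matrix.mul_apply, Fintype.sum_prod_type, P, Q, Matrix.of_apply, Matrix.smul_apply,
      Matrix.one_apply, Prod.mk.injEq, ite_mul, zero_mul, mul_ite, mul_zero, smul_eq_mul, mul_one]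
    by_cases hlj : l = j
    · subst hlj
      have h1 : ∀ χ : ZMod 13, ψ (-(χ * (fourPow (-l) * x))) * ψ (χ * (fourPow (-l) * y)) =
          ψ (χ * (fourPow (-l) * (y - x))) := fun χ => by
        rw [← AddChar.map_add_eq_mul]; congr 1; ring
      have h2 : fourPow (-l) * (y - x) = 0 ↔ x = y := by
        constructor
        · intro h
          have := congrArg (fourPow l * ·) h
          simp only [← mul_assoc, fourPow_mul_neg, one_mul, mul_zero] at this
          exact (sub_eq_zero.mp this).symm
        · rintro rfl; simp
      rw [Finset.sum_eq_single l]
      · simp [h1, sum_addChar_mul hψ, h2]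
      · intro b _ hb
        simp [hb]
      · simp
    · rw [if_neg (by tauto)]
      refine Finset.sum_eq_zero fun i _ => Finset.sum_eq_zero fun χ _ => ?_
      by_cases h1 : i = j
      · subst h1
        simp [hlj]
      · simp [h1]
  have hP : P.det ≠ 0 := by
    intro h
    have := congrArg Matrix.det hPQ
    rw [Matrix.det_mul, h, zero_mul, Matrix.det_smul, Matrix.det_one, mul_one] at this
    exact pow_ne_zero _ (by norm_num) this.symm
  -- The columns of `P` with fixed χ span a copy of the representation induced by the character χ.
  have hAP : A * P = P * Matrix.blockDiagonal fun χ : ZMod 13 =>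
      inducedMatrix f (ψ.mulShift χ) := by
    ext ⟨l, x⟩ ⟨j, χ⟩
    simp only [Matrix.mul_apply, Fintype.sum_prod_type, P, A, Matrix.of_apply,
      Matrix.blockDiagonal_apply, inducedMatrix]
    rw [Finset.sum_eq_single j (fun b _ hb => by simp [hb]) (by simp),
      Finset.sum_eq_single l (fun b _ hb => by simp [hb.symm]) (by simp)]
    simp only [if_true, AddChar.mulShift_apply, mul_ite, mul_zero, Finset.sum_ite_eq',
      Finset.mem_univ, Finset.mul_sum]
    refine Fintype.sum_equiv ⟨fun y => x - fourPow (l - j) * y,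
      fun t => fourPow (-(l - j)) * (x - t), fun y => ?_, fun t => ?_⟩ _ _ fun y => ?_
    · linear_combination y * fourPow_neg_mul (l - j)
    · linear_combination (t - x) * fourPow_mul_neg (l - j)
    · simp only [Equiv.coe_fn_mk]
      rw [mul_left_comm (ψ _), ← AddChar.map_add_eq_mul]
      congr 2
      have : fourPow (-l) * fourPow (l - j) = fourPow (-j) := by
        rw [← fourPow_add]; congr 1; ring
      linear_combination χ * y * this
  have := congrArg Matrix.det hAP
  rw [Matrix.det_mul, Matrix.det_mul, mul_comm, Matrix.det_blockDiagonal] at this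
  rw [hA]
  exact mul_left_cancel₀ hP this

/-! ### Gaussian periods modulo 13. -/

/-- The sum of the values of `ψ` at the nonzero squares of `ℤ/13`. -/
def squareSum {R : Type*} [CommRing R] (ψ : ZMod 13 → R) : R :=
  ψ 1 + ψ 3 + ψ 4 + ψ 9 + ψ 10 + ψ 12

/-- The sum of the values of `ψ` at the nonsquares of `ℤ/13`. -/
def nonsquareSum {R : Type*} [CommRing R] (ψ : ZMod 13 → R) : R :=
  ψ 2 + ψ 5 + ψ 6 + ψ 7 + ψ 8 + ψ 11

theorem addChar_apply_eq_pow {R : Type*} [CommRing R] (ψ : AddChar (ZMod 13) R) (a : ZMod 13) :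
    ψ a = ψ 1 ^ a.val := by
  rw [← AddChar.map_nsmul_eq_pow, nsmul_eq_mul, mul_one, ZMod.natCast_zmod_val]

theorem addChar_one_pow {R : Type*} [CommRing R] (ψ : AddChar (ZMod 13) R) :
    ψ 1 ^ 13 = 1 := by
  rw [← AddChar.map_nsmul_eq_pow]
  exact ψ.map_zero_eq_one

theorem squareSum_eq {R : Type*} [CommRing R] (ψ : AddChar (ZMod 13) R) :
    squareSum ψ = ψ 1 + ψ 1 ^ 3 + ψ 1 ^ 4 + ψ 1 ^ 9 + ψ 1 ^ 10 + ψ 1 ^ 12 := by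
  rw [squareSum, addChar_apply_eq_pow ψ 3, addChar_apply_eq_pow ψ 4, addChar_apply_eq_pow ψ 9,
    addChar_apply_eq_pow ψ 10, addChar_apply_eq_pow ψ 12]
  rfl

theorem nonsquareSum_eq {R : Type*} [CommRing R] (ψ : AddChar (ZMod 13) R) :
    nonsquareSum ψ = ψ 1 ^ 2 + ψ 1 ^ 5 + ψ 1 ^ 6 + ψ 1 ^ 7 + ψ 1 ^ 8 + ψ 1 ^ 11 := by
  rw [nonsquareSum, addChar_apply_eq_pow ψ 2, addChar_apply_eq_pow ψ 5, addChar_apply_eq_pow ψ 6,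
    addChar_apply_eq_pow ψ 7, addChar_apply_eq_pow ψ 8, addChar_apply_eq_pow ψ 11]
  rfl

/-- The product is expanded modulo z¹³ = 1 only, without using 1 + S + N = 0, so the relation also
covers the trivial character. -/
theorem squareSum_mul_nonsquareSum {R : Type*} [CommRing R] (ψ : AddChar (ZMod 13) R) :
    squareSum ψ * nonsquareSum ψ = 3 * squareSum ψ + 3 * nonsquareSum ψ := by
  have h := addChar_one_pow ψ
  rw [squareSum_eq, nonsquareSum_eq]
  generalize ψ 1 = z at h ⊢
  linear_combination (3 * z + 3 * z ^ 2 + 2 * z ^ 3 + 3 * z ^ 4 + 2 * z ^ 5 + 1 * z ^ 6 +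
    2 * z ^ 7 + 1 * z ^ 8 + 1 * z ^ 10) * h

theorem squareSum_sq {R : Type*} [CommRing R] (ψ : AddChar (ZMod 13) R) :
    squareSum ψ ^ 2 = 6 + 2 * squareSum ψ + 3 * nonsquareSum ψ := by
  have h := addChar_one_pow ψ
  rw [squareSum_eq, nonsquareSum_eq]
  generalize ψ 1 = z at h ⊢
  linear_combination (6 + 2 * z + 2 * z ^ 2 + 2 * z ^ 3 + 1 * z ^ 5 + 2 * z ^ 6 + 1 * z ^ 7 +
    2 * z ^ 8 + 2 * z ^ 9 + 1 * z ^ 11) * h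

/-- The nonzero squares of `ℤ/13`. -/
def squares : Finset (ZMod 13) := {1, 3, 4, 9, 10, 12}

/-- The nonsquares of `ℤ/13`. -/
def nonsquares : Finset (ZMod 13) := {2, 5, 6, 7, 8, 11}

theorem squareSum_eq_sum {R : Type*} [CommRing R] (f : ZMod 13 → R) :
    squareSum f = ∑ a ∈ squares, f a := by
  rw [squares, Finset.sum_insert (by decide), Finset.sum_insert (by decide),
    Finset.sum_insert (by decide), Finset.sum_insert (by decide), Finset.sum_insert (by decide),
    Finset.sum_singleton, squareSum]
  ring

theorem nonsquareSum_eq_sum {R : Type*} [CommRing R] (f : ZMod 13 → R) :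
    nonsquareSum f = ∑ a ∈ nonsquares, f a := by
  rw [nonsquares, Finset.sum_insert (by decide), Finset.sum_insert (by decide),
    Finset.sum_insert (by decide), Finset.sum_insert (by decide), Finset.sum_insert (by decide),
    Finset.sum_singleton, nonsquareSum]
  ring

theorem sum_eq_add_squareSum_add_nonsquareSum {R : Type*} [CommRing R] (f : ZMod 13 → R) :
    ∑ a, f a = f 0 + squareSum f + nonsquareSum f := by
  have h : (Finset.univ : Finset (ZMod 13)) = insert 0 (squares ∪ nonsquares) := by decide
  rw [h, Finset.sum_insert (by decide), Finset.sum_union (by decide), squareSum_eq_sum,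
    nonsquareSum_eq_sum, add_assoc]

theorem prod_eq_mul_prod_squares {R : Type*} [CommRing R] (f : ZMod 13 → R) :
    ∏ a, f a = f 0 * ((∏ a ∈ squares, f a) * ∏ a ∈ nonsquares, f a) := by
  have h : (Finset.univ : Finset (ZMod 13)) = insert 0 (squares ∪ nonsquares) := by decide
  rw [h, Finset.prod_insert (by decide), Finset.prod_union (by decide)]

theorem sum_mul_left_of_image {R : Type*} [CommRing R] (f : ZMod 13 → R) {χ : ZMod 13}
    {s t : Finset (ZMod 13)} (hχ : χ ≠ 0) (h : s.image (χ * ·) = t) :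
    ∑ a ∈ s, f (χ * a) = ∑ a ∈ t, f a := by
  have : Fact (Nat.Prime 13) := ⟨by norm_num⟩
  rw [← h, Finset.sum_image fun a _ b _ hab => mul_left_cancel₀ hχ hab]

theorem mulShift_sums_of_mem_squares {R : Type*} [CommRing R] (ψ : AddChar (ZMod 13) R)
    {χ : ZMod 13} (h : χ ∈ squares) :
    squareSum (ψ.mulShift χ) = squareSum ψ ∧ nonsquareSum (ψ.mulShift χ) = nonsquareSum ψ := by
  have key : ∀ χ ∈ squares, χ ≠ 0 ∧ squares.image (χ * ·) = squares ∧
    nonsquares.image (χ * ·) = nonsquares := by decide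
  obtain ⟨h0, h1, h2⟩ := key χ h
  simp only [squareSum_eq_sum, nonsquareSum_eq_sum, AddChar.mulShift_apply]
  exact ⟨sum_mul_left_of_image _ h0 h1, sum_mul_left_of_image _ h0 h2⟩

theorem mulShift_sums_of_mem_nonsquares {R : Type*} [CommRing R] (ψ : AddChar (ZMod 13) R)
    {χ : ZMod 13} (h : χ ∈ nonsquares) :
    squareSum (ψ.mulShift χ) = nonsquareSum ψ ∧ nonsquareSum (ψ.mulShift χ) = squareSum ψ := by
  have key : ∀ χ ∈ nonsquares, χ ≠ 0 ∧ squares.image (χ * ·) = nonsquares ∧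
    nonsquares.image (χ * ·) = squares := by decide
  obtain ⟨h0, h1, h2⟩ := key χ h
  simp only [squareSum_eq_sum, nonsquareSum_eq_sum, AddChar.mulShift_apply]
  exact ⟨sum_mul_left_of_image _ h0 h1, sum_mul_left_of_image _ h0 h2⟩

/-- The norm form of `t₀ + t₁ η + t₂ η'`, where `η` and `η'` are the two Gaussian periods
`(-1 ± √13) / 2`. -/
def periodNorm (t₀ t₁ t₂ : ℤ) : ℤ :=
  t₀ ^ 2 - t₀ * t₁ - t₀ * t₂ - 3 * t₁ ^ 2 - 3 * t₂ ^ 2 + 7 * t₁ * t₂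

theorem exists_primitive_addChar : ∃ ψ : AddChar (ZMod 13) ℂ, ψ.IsPrimitive :=
  ⟨_, AddChar.zmodChar_primitive_of_primitive_root 13
    (Complex.isPrimitiveRoot_exp 13 (by norm_num))⟩

/-- Shifting ψ by one of the six squares fixes both periods, by one of the six nonsquares swaps
them, and by 0 turns both into 6. Conjugate values multiply to the norm because S + N = -1 and SN =
-3. -/
theorem groupDeterminant_eq_of_det_inducedMatrix {F : MonoidAlgebra ℤ Z13Z6} {t₀ t₁ t₂ : ℤ}
    (h : ∀ ψ : AddChar (ZMod 13) ℂ, (inducedMatrix (monomialCoeff F) ψ).det =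
      t₀ + t₁ * squareSum ψ + t₂ * nonsquareSum ψ) :
    groupDeterminant F = (t₀ + 6 * t₁ + 6 * t₂) * periodNorm t₀ t₁ t₂ ^ 6 := by
  obtain ⟨ψ, hψ⟩ := exists_primitive_addChar
  have hsum : 1 + squareSum ψ + nonsquareSum ψ = 0 := by
    have h1 := sum_addChar_mul hψ 1
    rw [if_neg (by decide)] at h1
    simp only [mul_one] at h1
    rw [← h1, sum_eq_add_squareSum_add_nonsquareSum, AddChar.map_zero_eq_one]
  have hprod := squareSum_mul_nonsquareSum ψ
  rw [← Int.cast_inj (α := ℂ), cast_groupDeterminant hψ, Finset.prod_congr rfl fun χ _ => h _,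
    prod_eq_mul_prod_squares,
    Finset.prod_congr rfl fun χ (hχ : χ ∈ squares) => by
      rw [(mulShift_sums_of_mem_squares ψ hχ).1, (mulShift_sums_of_mem_squares ψ hχ).2],
    Finset.prod_congr rfl fun χ (hχ : χ ∈ nonsquares) => by
      rw [(mulShift_sums_of_mem_nonsquares ψ hχ).1, (mulShift_sums_of_mem_nonsquares ψ hχ).2],
    Finset.prod_const, Finset.prod_const, show squares.card = 6 from rfl,
    show nonsquares.card = 6 from rfl, ← mul_pow]
  have h0 : squareSum (ψ.mulShift 0) = 6 ∧ nonsquareSum (ψ.mulShift 0) = 6 := by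
    simp only [squareSum, nonsquareSum, AddChar.mulShift_apply, zero_mul, AddChar.map_zero_eq_one]
    norm_num
  have hnorm : (t₀ + t₁ * squareSum ψ + t₂ * nonsquareSum ψ) *
      (t₀ + t₁ * nonsquareSum ψ + t₂ * squareSum ψ) = ((periodNorm t₀ t₁ t₂ : ℤ) : ℂ) := by
    have hN : nonsquareSum ψ = -1 - squareSum ψ := by linear_combination hsum
    rw [hN] at hprod ⊢
    simp only [periodNorm]
    push_cast
    linear_combination ((t₁ : ℂ) ^ 2 + t₂ ^ 2 - 2 * t₁ * t₂) * hprod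
  rw [h0.1, h0.2, hnorm]
  push_cast
  ring

/-! ### Induced determinants are periods. -/

/-- The ring homomorphism from the group ring of `ℤ/13` defined by a character. -/
noncomputable def charEval {R : Type*} [CommRing R] (ψ : AddChar (ZMod 13) R) :
    MonoidAlgebra ℤ (Multiplicative (ZMod 13)) →+* R :=
  (MonoidAlgebra.lift ℤ R (Multiplicative (ZMod 13)) ψ.toMonoidHom).toRingHom

theorem charEval_single {R : Type*} [CommRing R] (ψ : AddChar (ZMod 13) R)
    (a : Multiplicative (ZMod 13)) (r : ℤ) :
    charEval ψ (MonoidAlgebra.single a r) = r * ψ a.toAdd := by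
  have : charEval ψ (MonoidAlgebra.single a r) = r • ψ.toMonoidHom a :=
    MonoidAlgebra.lift_single _ _ _
  rw [this, zsmul_eq_mul]
  rfl

theorem charEval_eq_sum {R : Type*} [CommRing R] (ψ : AddChar (ZMod 13) R)
    (u : MonoidAlgebra ℤ (Multiplicative (ZMod 13))) :
    charEval ψ u = ∑ a : ZMod 13, (u.coeff (Multiplicative.ofAdd a) : R) * ψ a := by
  have : charEval ψ u = u.coeff.sum fun a b => b • ψ.toMonoidHom a :=
    MonoidAlgebra.lift_apply _ _
  rw [this, Finsupp.sum_fintype _ _ (by simp)]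
  refine Fintype.sum_equiv Multiplicative.toAdd _ _ fun a => ?_
  rw [zsmul_eq_mul]
  rfl

/-- The automorphism `X ↦ X ^ 4` of the group ring of `ℤ/13`. -/
noncomputable def frobFour : MonoidAlgebra ℤ (Multiplicative (ZMod 13)) →+*
    MonoidAlgebra ℤ (Multiplicative (ZMod 13)) :=
  MonoidAlgebra.mapDomainRingHom ℤ (AddMonoidHom.toMultiplicative (AddMonoidHom.mulLeft (4 : ZMod 13)))

/-- The determinant is computed once, in the group ring of ℤ/13 with its tautological character, and
then specialised. The same integers thus serve complex characters and the trivial character over ℤ.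
-/
theorem exists_det_inducedMatrix (f : ZMod 6 → ZMod 13 → ℤ) :
    ∃ t₀ t₁ t₂ : ℤ, ∀ (R : Type) [CommRing R] (ψ : AddChar (ZMod 13) R),
      (inducedMatrix f ψ).det = t₀ + t₁ * squareSum ψ + t₂ * nonsquareSum ψ := by
  let X : ZMod 13 → MonoidAlgebra ℤ (Multiplicative (ZMod 13)) := fun a =>
    MonoidAlgebra.single (Multiplicative.ofAdd a) 1
  let d := (inducedMatrix f X).det
  have hX : ∀ a, frobFour (X a) = X (4 * a) := fun a => MonoidAlgebra.mapDomain_single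
  have hd : frobFour d = d := by
    -- Applying X ↦ X⁴ to the entries is undone by a simultaneous shift of rows and columns.
    rw [RingHom.map_det, ← Matrix.det_submatrix_equiv_self (Equiv.addRight (1 : ZMod 6))]
    congr 1
    ext1 l j
    simp only [Matrix.submatrix_apply, RingHom.mapMatrix_apply, Matrix.map_apply, inducedMatrix,
      Matrix.of_apply, map_sum, map_mul, map_intCast, hX, Equiv.coe_addRight,
      add_sub_add_right_eq_sub]
    refine Finset.sum_congr rfl fun t _ => ?_
    have h4 : 4 * fourPow (-(l + 1)) = fourPow (-l) := by
      rw [show (4 : ZMod 13) = fourPow 1 from rfl, ← fourPow_add]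
      congr 1
      ring
    rw [← mul_assoc, h4]
  have hcoeff : ∀ a : ZMod 13, d.coeff (Multiplicative.ofAdd (4 * a)) =
      d.coeff (Multiplicative.ofAdd a) := fun a => by
    conv_lhs => rw [← hd]
    refine Finsupp.mapDomain_apply (f := AddMonoidHom.toMultiplicative
      (AddMonoidHom.mulLeft (4 : ZMod 13))) ?_ d.coeff (Multiplicative.ofAdd a)
    have : ∀ a b : ZMod 13, 4 * a = 4 * b → a = b := by decide
    exact fun a b h => this _ _ h
  obtain ⟨c, hc⟩ : ∃ c : ZMod 13 → ℤ, ∀ a, d.coeff (Multiplicative.ofAdd a) = c a :=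
    ⟨_, fun _ => rfl⟩
  simp only [hc] at hcoeff
  -- The coefficients are followed along the orbit 1, 4, 3, 12, 9, 10 of multiplication by 4, and
  -- below along 2, 8, 6, 11, 5, 7.
  have hsq : c 4 = c 1 ∧ c 3 = c 1 ∧ c 12 = c 1 ∧ c 9 = c 1 ∧ c 10 = c 1 := by
    have h1 : c 4 = c 1 := hcoeff 1
    have h2 : c 3 = c 4 := hcoeff 4
    have h3 : c 12 = c 3 := hcoeff 3
    have h4 : c 9 = c 12 := hcoeff 12
    have h5 : c 10 = c 9 := hcoeff 9
    simp [h1, h2, h3, h4, h5]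
  have hns : c 8 = c 2 ∧ c 6 = c 2 ∧ c 11 = c 2 ∧ c 5 = c 2 ∧ c 7 = c 2 := by
    have h1 : c 8 = c 2 := hcoeff 2
    have h2 : c 6 = c 8 := hcoeff 8
    have h3 : c 11 = c 6 := hcoeff 6
    have h4 : c 5 = c 11 := hcoeff 11
    have h5 : c 7 = c 5 := hcoeff 5
    simp [h1, h2, h3, h4, h5]
  refine ⟨c 0, c 1, c 2, fun R _ ψ => ?_⟩
  have hψ : (inducedMatrix f ψ).det = charEval ψ d := by
    rw [RingHom.map_det]
    congr 1
    ext1 l j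
    simp only [RingHom.mapMatrix_apply, Matrix.map_apply, inducedMatrix, Matrix.of_apply, map_sum,
      map_mul, map_intCast, X, charEval_single, Int.cast_one, one_mul, toAdd_ofAdd]
  rw [hψ, charEval_eq_sum, sum_eq_add_squareSum_add_nonsquareSum]
  simp only [squareSum, nonsquareSum, AddChar.map_zero_eq_one, hc]
  rw [hsq.1, hsq.2.1, hsq.2.2.1, hsq.2.2.2.1, hsq.2.2.2.2, hns.1, hns.2.1, hns.2.2.1,
    hns.2.2.2.1, hns.2.2.2.2]
  ring

/-! ### Circulant determinants of order six. -/

theorem det_fromBlocks_swap {n R : Type*} [Fintype n] [DecidableEq n] [CommRing R]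
    (A B : Matrix n n R) :
    (Matrix.fromBlocks A B B A).det = (A + B).det * (A - B).det := by
  have h : Matrix.fromBlocks 1 1 0 1 * Matrix.fromBlocks A B B A * Matrix.fromBlocks 1 (-1) 0 1 =
      Matrix.fromBlocks (A + B) 0 B (A - B) := by
    simp only [Matrix.fromBlocks_multiply]
    congr 1 <;> simp [sub_eq_neg_add, add_comm]
    abel
  have := congrArg Matrix.det h
  rw [Matrix.det_mul, Matrix.det_mul, Matrix.det_fromBlocks_zero₁₂] at this
  simpa using this

/-- The determinant of a `3 × 3` circulant matrix. -/
def circulantCubic (a b c : ℤ) : ℤ := a ^ 3 + b ^ 3 + c ^ 3 - 3 * a * b * c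

theorem det_circulant_six (g : ZMod 6 → ℤ) :
    Matrix.det (Matrix.of fun l j : ZMod 6 => g (l - j)) =
      circulantCubic (g 0 + g 3) (g 4 + g 1) (g 2 + g 5) *
        circulantCubic (g 0 - g 3) (g 4 - g 1) (g 2 - g 5) := by
  -- This order lists {0, 4, 2} and then its translate by 3, exhibiting ℤ/6 as ℤ/3 × ℤ/2.
  let e : Fin 3 ⊕ Fin 3 ≃ ZMod 6 :=
    Equiv.ofBijective (Sum.elim ![0, 4, 2] ![3, 1, 5]) (by decide)
  let A : Matrix (Fin 3) (Fin 3) ℤ := !![g 0, g 2, g 4; g 4, g 0, g 2; g 2, g 4, g 0]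
  let B : Matrix (Fin 3) (Fin 3) ℤ := !![g 3, g 5, g 1; g 1, g 3, g 5; g 5, g 1, g 3]
  have h : (Matrix.of fun l j : ZMod 6 => g (l - j)).submatrix e e = Matrix.fromBlocks A B B A := by
    ext i j
    rcases i with i | i <;> rcases j with j | j <;> fin_cases i <;> fin_cases j <;>
      exact congrArg g (by decide)
  rw [← Matrix.det_submatrix_equiv_self e, h, det_fromBlocks_swap, Matrix.det_fin_three,
    Matrix.det_fin_three]
  simp only [A, B, Matrix.add_apply, Matrix.sub_apply, Matrix.of_apply, Matrix.cons_val,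
    circulantCubic]
  ring

/-- The two factors of the order-six determinant agree modulo 2, so an even product is divisible by
4. -/
theorem two_dvd_circulantCubic_iff (a b c a' b' c' : ℤ) :
    2 ∣ circulantCubic (a + a') (b + b') (c + c') ↔
      2 ∣ circulantCubic (a - a') (b - b') (c - c') := by
  have h : (2 : ℤ) ∣ circulantCubic (a + a') (b + b') (c + c') -
      circulantCubic (a - a') (b - b') (c - c') := by
    refine ⟨3 * a ^ 2 * a' + a' ^ 3 + 3 * b ^ 2 * b' + b' ^ 3 + 3 * c ^ 2 * c' + c' ^ 3 -
      3 * (a' * b * c + a * b' * c + a * b * c' + a' * b' * c'), ?_⟩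
    simp only [circulantCubic]
    ring
  exact (dvd_iff_dvd_of_dvd_sub h)

/-- The cubic is s(s² - 3q) with s = a + b + c, hence s³ modulo 3. Once 3 ∣ s, both factors are
divisible by 3. -/
theorem nine_dvd_circulantCubic {a b c : ℤ} (h : 3 ∣ circulantCubic a b c) :
    9 ∣ circulantCubic a b c := by
  have hs : (3 : ℤ) ∣ (a + b + c) ^ 3 := by
    have : (a + b + c) ^ 3 = circulantCubic a b c + 3 * (a ^ 2 * b + a ^ 2 * c + b ^ 2 * a +
      b ^ 2 * c + c ^ 2 * a + c ^ 2 * b + 3 * (a * b * c)) := by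
      simp only [circulantCubic]
      ring
    rw [this]
    exact dvd_add h ⟨_, rfl⟩
  obtain ⟨s, hs⟩ := Int.prime_three.dvd_of_dvd_pow hs
  refine ⟨s * (3 * s ^ 2 - (a * b + b * c + c * a)), ?_⟩
  have : circulantCubic a b c =
      (a + b + c) * ((a + b + c) ^ 2 - 3 * (a * b + b * c + c * a)) := by
    simp only [circulantCubic]
    ring
  rw [this, hs]
  ring

theorem det_circulant_six_dvd (g : ZMod 6 → ℤ) {m : ℤ}
    (hm : m = Matrix.det (Matrix.of fun l j : ZMod 6 => g (l - j))) :
    (Odd m ∨ (4 : ℤ) ∣ m) ∧ (¬ (3 : ℤ) ∣ m ∨ (9 : ℤ) ∣ m) := by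
  rw [det_circulant_six] at hm
  have h2 := two_dvd_circulantCubic_iff (g 0) (g 4) (g 2) (g 3) (g 1) (g 5)
  have h9 := @nine_dvd_circulantCubic (g 0 + g 3) (g 4 + g 1) (g 2 + g 5)
  have h9' := @nine_dvd_circulantCubic (g 0 - g 3) (g 4 - g 1) (g 2 - g 5)
  generalize circulantCubic (g 0 + g 3) (g 4 + g 1) (g 2 + g 5) = u at *
  generalize circulantCubic (g 0 - g 3) (g 4 - g 1) (g 2 - g 5) = v at *
  subst hm
  constructor
  · rcases Int.even_or_odd (u * v) with h | h
    · right
      have huv : 2 ∣ u ∧ 2 ∣ v := by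
        rcases Int.prime_two.dvd_or_dvd h.two_dvd with h | h <;> tauto
      exact mul_dvd_mul huv.1 huv.2
    · exact Or.inl h
  · by_cases h : (3 : ℤ) ∣ u * v
    · right
      rcases Int.prime_three.dvd_or_dvd h with h | h
      · exact (h9 h).mul_right _
      · exact (h9' h).mul_left _
    · exact Or.inl h

theorem exists_groupDeterminant_eq (F : MonoidAlgebra ℤ Z13Z6) :
    ∃ t₀ t₁ t₂ : ℤ, groupDeterminant F = (t₀ + 6 * t₁ + 6 * t₂) * periodNorm t₀ t₁ t₂ ^ 6 ∧
      (Odd (t₀ + 6 * t₁ + 6 * t₂) ∨ (4 : ℤ) ∣ t₀ + 6 * t₁ + 6 * t₂) ∧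
      (¬ (3 : ℤ) ∣ t₀ + 6 * t₁ + 6 * t₂ ∨ (9 : ℤ) ∣ t₀ + 6 * t₁ + 6 * t₂) := by
  obtain ⟨t₀, t₁, t₂, h⟩ := exists_det_inducedMatrix (monomialCoeff F)
  refine ⟨t₀, t₁, t₂, groupDeterminant_eq_of_det_inducedMatrix fun ψ => h ℂ ψ,
    det_circulant_six_dvd (fun i => ∑ t, monomialCoeff F i t) ?_⟩
  -- The trivial character identifies m with a circulant determinant.
  have h1 := h ℤ 1
  have h2 : inducedMatrix (monomialCoeff F) (1 : AddChar (ZMod 13) ℤ) =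
      Matrix.of fun l j : ZMod 6 => ∑ t, monomialCoeff F (l - j) t := by
    ext l j
    simp [inducedMatrix]
  rw [← h2, h1]
  simp only [squareSum, nonsquareSum, AddChar.one_apply, Int.cast_id]
  ring

/-! ### Norms from ℚ(√13). -/

theorem norm_add_mul_sqrt13 (a b : ℚ) :
    Algebra.norm ℚ (algebraMap ℚ QSqrt13 a + algebraMap ℚ QSqrt13 b * sqrt13) =
      a ^ 2 - 13 * b ^ 2 := by
  have hirr : Irrational (Real.sqrt 13) := by
    simpa using (show Nat.Prime 13 by norm_num).irrational_sqrt
  have hint : IsIntegral ℚ (Real.sqrt 13) :=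
    ⟨Polynomial.X ^ 2 - Polynomial.C 13, Polynomial.monic_X_pow_sub_C _ (by norm_num), by simp⟩
  have hmin : minpoly ℚ (Real.sqrt 13) = Polynomial.X ^ 2 - Polynomial.C 13 := by
    symm
    refine minpoly.eq_of_irreducible_of_monic ?_ (by simp)
      (Polynomial.monic_X_pow_sub_C _ (by norm_num))
    rw [Polynomial.irreducible_iff_roots_eq_zero_of_degree_le_three]
    · refine Multiset.eq_zero_of_forall_notMem fun x hx => ?_
      have hx2 : x ^ 2 = 13 := by
        have := Polynomial.isRoot_of_mem_roots hx
        simpa [sub_eq_zero] using this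
      have h2 : (|x| : ℝ) = Real.sqrt 13 := by
        rw [← Real.sqrt_sq_eq_abs]
        congr 1
        exact_mod_cast hx2
      exact hirr ⟨|x|, by rw [← h2]; push_cast; rfl⟩
    · rw [Polynomial.natDegree_X_pow_sub_C]
    · rw [Polynomial.natDegree_X_pow_sub_C]; norm_num
  let pb := IntermediateField.adjoin.powerBasis hint
  have hgen : pb.gen = sqrt13 := IntermediateField.adjoin.powerBasis_gen hint
  have hdim : pb.dim = 2 := by
    rw [IntermediateField.adjoin.powerBasis_dim, hmin, Polynomial.natDegree_X_pow_sub_C]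
  have hsq : sqrt13 * sqrt13 = algebraMap ℚ QSqrt13 13 := by
    apply Subtype.ext
    change Real.sqrt 13 * Real.sqrt 13 = algebraMap ℚ ℝ 13
    rw [Real.mul_self_sqrt (by norm_num)]
    simp
  let b₂ : Module.Basis (Fin 2) ℚ QSqrt13 := pb.basis.reindex (finCongr hdim)
  have h0 : b₂ 0 = 1 := by simp [b₂]
  have h1 : b₂ 1 = sqrt13 := by simp [b₂, hgen]
  rw [Algebra.norm_eq_matrix_det b₂]
  have hM : Algebra.leftMulMatrix b₂ (algebraMap ℚ QSqrt13 a + algebraMap ℚ QSqrt13 b * sqrt13) =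
      !![a, 13 * b; b, a] := by
    ext i j
    rw [Algebra.leftMulMatrix_eq_repr_mul]
    fin_cases j
    · have : (algebraMap ℚ QSqrt13 a + algebraMap ℚ QSqrt13 b * sqrt13) * b₂ 0 =
          a • b₂ 0 + b • b₂ 1 := by
        rw [h0, h1, Algebra.smul_def, Algebra.smul_def, mul_one, mul_one]
      change b₂.repr (_ * b₂ 0) i = _
      rw [this]
      fin_cases i <;> simp
    · have : (algebraMap ℚ QSqrt13 a + algebraMap ℚ QSqrt13 b * sqrt13) * b₂ 1 =
          (13 * b) • b₂ 0 + a • b₂ 1 := by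
        rw [h0, h1, Algebra.smul_def, Algebra.smul_def, add_mul, mul_assoc, hsq, map_mul]
        ring
      change b₂.repr (_ * b₂ 1) i = _
      rw [this]
      fin_cases i <;> simp
  rw [hM, Matrix.det_fin_two_of]
  ring

/-- The element equals t₀ + t₁η + t₂η' with η, η' = (-1 ± √13) / 2. The substitution is invertible
over ℤ, so it serves both inclusions. -/
theorem norm_eq_periodNorm (t₀ t₁ t₂ m α β : ℤ) (hm : m = t₀ + 6 * t₁ + 6 * t₂)
    (hα : α = -t₁) (hβ : β = t₁ - t₂) :
    Algebra.norm ℚ ((m : QSqrt13) + 13 * (α : QSqrt13) + (1 / 2) * (13 + sqrt13) * (β : QSqrt13)) =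
      periodNorm t₀ t₁ t₂ := by
  have : (m : QSqrt13) + 13 * (α : QSqrt13) + (1 / 2) * (13 + sqrt13) * (β : QSqrt13) =
      algebraMap ℚ QSqrt13 (m + 13 * α + 13 / 2 * β) +
        algebraMap ℚ QSqrt13 (β / 2) * sqrt13 := by
    simp only [map_add, map_mul, map_div₀, map_ofNat, map_intCast]
    ring
  rw [this, norm_add_mul_sqrt13, hm, hα, hβ, periodNorm]
  push_cast
  ring

/-! ### Rank-two perturbations of circulants. -/

/-- The pairing `∑ Y j * e (j - l) * X l`. -/
def circulantPairing {K : Type*} [CommRing K] (Y e X : ZMod 6 → K) : K :=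
  ∑ j, ∑ l, Y j * (e (j - l) * X l)

theorem circulantPairing_eq {K : Type*} [CommRing K] (Y e X : ZMod 6 → K) :
    circulantPairing Y e X = ∑ l, ∑ k, e k * (Y (k + l) * X l) := by
  simp only [circulantPairing]
  rw [Finset.sum_comm]
  refine Finset.sum_congr rfl fun l _ => ?_
  refine Fintype.sum_equiv (Equiv.subRight l) _ _ fun j => ?_
  rw [Equiv.subRight_apply, sub_add_cancel]
  ring

/-- The determinant of a perturbation of rank two of a circulant matrix. -/
theorem det_circulant_add {K : Type*} [Field K] {c : K} (hc : c ≠ 0) {a e : ZMod 6 → K}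
    (hae : ∀ i, ∑ j, a (i - j) * e j = if i = 0 then c ^ 2 else 0)
    (hdet : (Matrix.of fun l j : ZMod 6 => a (l - j)).det = c ^ 2) (he : ∑ i, e i = c)
    (X Y W : ZMod 6 → K) :
    c * (Matrix.of fun l j : ZMod 6 => a (l - j) + X l * Y j + W l).det =
      (c ^ 2 + circulantPairing Y e X) * (c + ∑ l, W l) -
        (∑ l, X l) * circulantPairing Y e W := by
  let A : Matrix (ZMod 6) (ZMod 6) K := Matrix.of fun l j => a (l - j)
  let E : Matrix (ZMod 6) (ZMod 6) K := Matrix.of fun l j => e (l - j)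
  let U : Matrix (ZMod 6) (Fin 2) K := Matrix.of fun l k => ![X l, W l] k
  let V : Matrix (Fin 2) (ZMod 6) K := Matrix.of fun k j => ![Y j, 1] k
  have hAE : A * E = c ^ 2 • (1 : Matrix (ZMod 6) (ZMod 6) K) := by
    ext l j
    simp only [A, E, Matrix.mul_apply, Matrix.of_apply, Matrix.smul_apply, Matrix.one_apply,
      smul_eq_mul, mul_ite, mul_one, mul_zero]
    rw [← Fintype.sum_equiv (Equiv.addRight j) (fun k => a (l - j - k) * e k) _ (fun k => by
      rw [Equiv.coe_addRight, add_sub_cancel_right]; congr 2; ring), hae]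
    simp only [sub_eq_zero]
  -- As A⁻¹ = c⁻²E, factoring out A leaves 1 + c⁻²(EU)V, and exchanging the factors reduces the
  -- determinant to size 2.
  have hM : (Matrix.of fun l j : ZMod 6 => a (l - j) + X l * Y j + W l) =
      A * (1 + ((c ^ 2)⁻¹ • (E * U)) * V) := by
    rw [mul_add, mul_one, Matrix.smul_mul, Matrix.mul_smul, Matrix.mul_assoc E U V,
      ← Matrix.mul_assoc A E, hAE, Matrix.smul_mul, Matrix.one_mul, smul_smul,
      inv_mul_cancel₀ (pow_ne_zero 2 hc), one_smul]
    ext l j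
    simp [A, U, V, Matrix.mul_apply, add_assoc]
  have hs : ∀ Z : ZMod 6 → K, ∑ j, ∑ l, e (j - l) * Z l = c * ∑ l, Z l := fun Z => by
    rw [Finset.sum_comm, Finset.mul_sum]
    refine Finset.sum_congr rfl fun l _ => ?_
    rw [← Finset.sum_mul, ← he]
    congr 1
    exact Fintype.sum_equiv (Equiv.subRight l) _ _ fun j => rfl
  have h00 : (V * (E * U)) 0 0 = circulantPairing Y e X := by
    simp [V, E, U, Matrix.mul_apply, circulantPairing, Finset.mul_sum]
  have h01 : (V * (E * U)) 0 1 = circulantPairing Y e W := by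
    simp [V, E, U, Matrix.mul_apply, circulantPairing, Finset.mul_sum]
  have h10 : (V * (E * U)) 1 0 = c * ∑ l, X l := by
    simp [V, E, U, Matrix.mul_apply, ← hs]
  have h11 : (V * (E * U)) 1 1 = c * ∑ l, W l := by
    simp [V, E, U, Matrix.mul_apply, ← hs]
  rw [hM, Matrix.det_mul, show A.det = c ^ 2 from hdet, Matrix.det_one_add_mul_comm,
    Matrix.mul_smul, Matrix.det_fin_two]
  simp only [Matrix.add_apply, Matrix.smul_apply, h00, h01, h10, h11, Matrix.one_apply_eq, ne_eq,
    zero_ne_one, one_ne_zero, not_false_eq_true, Matrix.one_apply_ne, smul_eq_mul]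
  field_simp
  ring

/-- The values of `∑ x s X ^ s` at the conjugates of the character `ψ`. -/
def conjSum {K : Type*} [CommRing K] (ψ : ZMod 13 → K) (x : ZMod 13 → ℤ) (l : ZMod 6) : K :=
  ∑ s, (x s : K) * ψ (fourPow (-l) * s)

/-- The coefficients of the group ring element `a(Y) + x(X) σ y(X) + w(X) σ`, where
`σ = 1 + Y + ⋯ + Y ^ 5`. -/
def perturbedCoeff (a : ZMod 6 → ℤ) (x y w : ZMod 13 → ℤ) (i : ZMod 6) (t : ZMod 13) : ℤ :=
  (if t = 0 then a i else 0) + ∑ s, x s * y (fourPow (-i) * (t - s)) + w t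

/-- In the induced representation X acts diagonally and σ as the all-ones matrix, so xσy becomes an
outer product and wσ has constant rows. -/
theorem inducedMatrix_perturbedCoeff {K : Type*} [CommRing K] (a : ZMod 6 → ℤ)
    (x y w : ZMod 13 → ℤ) (ψ : AddChar (ZMod 13) K) :
    inducedMatrix (perturbedCoeff a x y w) ψ = Matrix.of fun l j : ZMod 6 =>
      (a (l - j) : K) + conjSum ψ x l * conjSum ψ y j + conjSum ψ w l := by
  ext l j
  have hxy : ∑ t, (∑ s, (x s : K) * y (fourPow (-(l - j)) * (t - s))) * ψ (fourPow (-l) * t) =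
      conjSum ψ x l * conjSum ψ y j := by
    simp only [conjSum, Finset.sum_mul]
    rw [Finset.sum_comm]
    refine Finset.sum_congr rfl fun s _ => ?_
    rw [Finset.mul_sum]
    refine Fintype.sum_equiv ⟨fun t => fourPow (-(l - j)) * (t - s),
      fun u => fourPow (l - j) * u + s, fun t => ?_, fun u => ?_⟩ _ _ fun t => ?_
    · linear_combination (t - s) * fourPow_mul_neg (l - j)
    · linear_combination u * fourPow_neg_mul (l - j)
    · simp only [Equiv.coe_fn_mk]
      have h1 : fourPow (-j) * fourPow (-(l - j)) = fourPow (-l) := by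
        rw [← fourPow_add]; congr 1; ring
      have h2 : ψ (fourPow (-l) * t) = ψ (fourPow (-l) * s) *
          ψ (fourPow (-j) * (fourPow (-(l - j)) * (t - s))) := by
        rw [← AddChar.map_add_eq_mul]
        congr 1
        linear_combination (s - t) * h1
      rw [h2]
      ring
  simp only [inducedMatrix, perturbedCoeff, Matrix.of_apply, Int.cast_add, add_mul,
    Finset.sum_add_distrib, Int.cast_sum, Int.cast_mul, hxy]
  simp [conjSum]

/-- The group ring element with given coefficients. -/
noncomputable def ofMonomialCoeff (f : ZMod 6 → ZMod 13 → ℤ) : MonoidAlgebra ℤ Z13Z6 :=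
  ⟨Finsupp.equivFunOnFinite.symm fun g => f g.right.toAdd g.left.toAdd⟩

theorem monomialCoeff_ofMonomialCoeff (f : ZMod 6 → ZMod 13 → ℤ) :
    monomialCoeff (ofMonomialCoeff f) = f := rfl

theorem nonsquareSum_sq {R : Type*} [CommRing R] (ψ : AddChar (ZMod 13) R) :
    nonsquareSum ψ ^ 2 = 6 + 3 * squareSum ψ + 2 * nonsquareSum ψ := by
  have h := addChar_one_pow ψ
  rw [squareSum_eq, nonsquareSum_eq]
  generalize ψ 1 = z at h ⊢
  linear_combination (6 + 3 * z + 2 * z ^ 2 + 3 * z ^ 3 + 2 * z ^ 4 + 2 * z ^ 5 + 2 * z ^ 6 +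
    1 * z ^ 9) * h

/-- The coefficients of `∑ e k * y(X ^ (4 ^ (-k))) * x(X)`. -/
def correlation (y : ZMod 13 → ℤ) (e : ZMod 6 → ℤ) (x : ZMod 13 → ℤ) (u : ZMod 13) : ℤ :=
  ∑ k, ∑ s, e k * (y s * x (u - fourPow (-k) * s))

/-- After grouping by k = j - l, the terms for different l are conjugate, so the pairing is a trace.
-/
theorem circulantPairing_conjSum {K : Type*} [CommRing K] (ψ : AddChar (ZMod 13) K)
    (y : ZMod 13 → ℤ) (e : ZMod 6 → ℤ) (x : ZMod 13 → ℤ) :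
    circulantPairing (conjSum ψ y) (fun k => (e k : K)) (conjSum ψ x) =
      ∑ l, conjSum ψ (correlation y e x) l := by
  rw [circulantPairing_eq]
  refine Finset.sum_congr rfl fun l _ => ?_
  simp only [conjSum, correlation, Int.cast_sum, Int.cast_mul, Finset.sum_mul]
  rw [Finset.sum_comm]
  refine Finset.sum_congr rfl fun k _ => ?_
  rw [Finset.sum_comm, Finset.mul_sum]
  refine Finset.sum_congr rfl fun s _ => ?_
  rw [Finset.mul_sum, Finset.mul_sum]
  refine Fintype.sum_equiv (Equiv.addRight (fourPow (-k) * s)) _ _ fun t => ?_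
  rw [Equiv.coe_addRight, add_sub_cancel_right, mul_add, AddChar.map_add_eq_mul, ← mul_assoc
    (fourPow (-l)), ← fourPow_add, show -l + -k = -(k + l) by ring]
  ring

/-! ### Determinants of perturbations as periods. -/

/-- The element `t₀ + t₁ S + t₂ N` of the ring of Gaussian periods, where `S` and `N` are the
sums over the squares and over the nonsquares. -/
def periodValue {R : Type*} [CommRing R] (ψ : ZMod 13 → R) (t : ℤ × ℤ × ℤ) : R :=
  t.1 + t.2.1 * squareSum ψ + t.2.2 * nonsquareSum ψ

/-- The product of two elements of the ring of Gaussian periods. -/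
def periodMul (t u : ℤ × ℤ × ℤ) : ℤ × ℤ × ℤ :=
  (t.1 * u.1 + 6 * t.2.1 * u.2.1 + 6 * t.2.2 * u.2.2,
    t.1 * u.2.1 + t.2.1 * u.1 + 2 * t.2.1 * u.2.1 + 3 * (t.2.1 * u.2.2 + t.2.2 * u.2.1) +
      3 * t.2.2 * u.2.2,
    t.1 * u.2.2 + t.2.2 * u.1 + 3 * t.2.1 * u.2.1 + 3 * (t.2.1 * u.2.2 + t.2.2 * u.2.1) +
      2 * t.2.2 * u.2.2)

theorem periodValue_mul {R : Type*} [CommRing R] (ψ : AddChar (ZMod 13) R) (t u : ℤ × ℤ × ℤ) :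
    periodValue ψ (periodMul t u) = periodValue ψ t * periodValue ψ u := by
  simp only [periodValue, periodMul]
  push_cast
  linear_combination (-(t.2.1 * u.2.1 : R)) * squareSum_sq ψ -
    (t.2.2 * u.2.2 : R) * nonsquareSum_sq ψ -
    (t.2.1 * u.2.2 + t.2.2 * u.2.1 : R) * squareSum_mul_nonsquareSum ψ

theorem periodValue_add {R : Type*} [CommRing R] (ψ : ZMod 13 → R) (t u : ℤ × ℤ × ℤ) :
    periodValue ψ (t + u) = periodValue ψ t + periodValue ψ u := by
  simp only [periodValue, Prod.fst_add, Prod.snd_add]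
  push_cast
  ring

theorem periodValue_sub {R : Type*} [CommRing R] (ψ : ZMod 13 → R) (t u : ℤ × ℤ × ℤ) :
    periodValue ψ (t - u) = periodValue ψ t - periodValue ψ u := by
  simp only [periodValue, Prod.fst_sub, Prod.snd_sub]
  push_cast
  ring

/-- The trace of `∑ x s X ^ s` in the ring of Gaussian periods. -/
def periodTrace (x : ZMod 13 → ℤ) : ℤ × ℤ × ℤ := (6 * x 0, squareSum x, nonsquareSum x)

theorem sum_fourPow {R : Type*} [CommRing R] (f : ZMod 13 → R) :
    ∑ l, f (fourPow (-l)) = squareSum f := by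
  have h : squares = Finset.univ.image fun l : ZMod 6 => fourPow (-l) := by decide
  rw [squareSum_eq_sum, h, Finset.sum_image fun a _ b _ hab => by revert a b; decide]

theorem sum_conjSum {R : Type*} [CommRing R] (ψ : AddChar (ZMod 13) R) (x : ZMod 13 → ℤ) :
    ∑ l, conjSum ψ x l = periodValue ψ (periodTrace x) := by
  have h1 : ∀ s, ∑ l, ψ (fourPow (-l) * s) = squareSum (ψ.mulShift s) := fun s => by
    rw [← sum_fourPow]
    simp only [AddChar.mulShift_apply, mul_comm]
  simp only [conjSum]
  rw [Finset.sum_comm]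
  simp only [← Finset.mul_sum, h1]
  rw [sum_eq_add_squareSum_add_nonsquareSum, squareSum_eq_sum fun a => (x a : R) * _,
    nonsquareSum_eq_sum fun a => (x a : R) * _,
    Finset.sum_congr rfl fun a (ha : a ∈ squares) => by
      rw [(mulShift_sums_of_mem_squares ψ ha).1],
    Finset.sum_congr rfl fun a (ha : a ∈ nonsquares) => by
      rw [(mulShift_sums_of_mem_nonsquares ψ ha).1],
    ← Finset.sum_mul, ← Finset.sum_mul, ← Int.cast_sum, ← Int.cast_sum, ← squareSum_eq_sum,
    ← nonsquareSum_eq_sum]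
  have h0 : squareSum (ψ.mulShift 0) = 6 := by
    simp only [squareSum, AddChar.mulShift_apply, zero_mul, AddChar.map_zero_eq_one]
    norm_num
  rw [h0]
  simp only [periodValue, periodTrace]
  push_cast
  ring

/-- The constant term of the determinant of a perturbed circulant matrix. -/
def perturbationBase (c : ℤ) (e : ZMod 6 → ℤ) (x y : ZMod 13 → ℤ) : ℤ × ℤ × ℤ :=
  (c ^ 2, 0, 0) + periodTrace (correlation y e x)

/-- The part of the determinant of a perturbed circulant matrix that is linear in `w`, multiplied
by `c`. -/
def perturbationForm (c : ℤ) (e : ZMod 6 → ℤ) (x y w : ZMod 13 → ℤ) : ℤ × ℤ × ℤ :=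
  periodMul (perturbationBase c e x y) (periodTrace w) -
    periodMul (periodTrace x) (periodTrace (correlation y e w))

theorem periodTrace_add (x y : ZMod 13 → ℤ) :
    periodTrace (x + y) = periodTrace x + periodTrace y := by
  simp only [periodTrace, squareSum, nonsquareSum, Pi.add_apply, Prod.mk_add_mk]
  ext <;> simp only <;> ring

theorem periodTrace_smul (n : ℤ) (x : ZMod 13 → ℤ) :
    periodTrace (n • x) = n • periodTrace x := by
  simp only [periodTrace, squareSum, nonsquareSum, Pi.smul_apply, smul_eq_mul, Prod.smul_mk]
  ext <;> simp only <;> ring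

theorem correlation_add (y : ZMod 13 → ℤ) (e : ZMod 6 → ℤ) (x x' : ZMod 13 → ℤ) :
    correlation y e (x + x') = correlation y e x + correlation y e x' := by
  ext u
  simp [correlation, mul_add, Finset.sum_add_distrib]

theorem correlation_smul (y : ZMod 13 → ℤ) (e : ZMod 6 → ℤ) (n : ℤ) (x : ZMod 13 → ℤ) :
    correlation y e (n • x) = n • correlation y e x := by
  ext u
  simp [correlation, Finset.mul_sum, mul_left_comm]

theorem perturbationForm_add (c : ℤ) (e : ZMod 6 → ℤ) (x y w w' : ZMod 13 → ℤ) :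
    perturbationForm c e x y (w + w') = perturbationForm c e x y w +
      perturbationForm c e x y w' := by
  simp only [perturbationForm, correlation_add, periodTrace_add, periodMul, Prod.fst_add,
    Prod.snd_add]
  ext <;> simp only [Prod.fst_add, Prod.snd_add, Prod.fst_sub, Prod.snd_sub] <;> ring

theorem perturbationForm_smul (c : ℤ) (e : ZMod 6 → ℤ) (x y : ZMod 13 → ℤ) (n : ℤ)
    (w : ZMod 13 → ℤ) :
    perturbationForm c e x y (n • w) = n • perturbationForm c e x y w := by
  simp only [perturbationForm, correlation_smul, periodTrace_smul, periodMul, Prod.smul_fst,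
    Prod.smul_snd, smul_eq_mul]
  ext <;> simp only [Prod.smul_fst, Prod.smul_snd, Prod.fst_sub, Prod.snd_sub, smul_eq_mul] <;>
    ring

theorem mul_det_perturbedCoeff {c : ℤ} (hc : c ≠ 0) {a e : ZMod 6 → ℤ}
    (hae : ∀ i, ∑ j, a (i - j) * e j = if i = 0 then c ^ 2 else 0)
    (hdet : (Matrix.of fun l j : ZMod 6 => a (l - j)).det = c ^ 2) (he : ∑ i, e i = c)
    (x y w : ZMod 13 → ℤ) {K : Type*} [Field K] [CharZero K] (ψ : AddChar (ZMod 13) K) :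
    c * (inducedMatrix (perturbedCoeff a x y w) ψ).det =
      c * periodValue ψ (perturbationBase c e x y) +
        periodValue ψ (perturbationForm c e x y w) := by
  have h := det_circulant_add (K := K) (c := c) (by exact_mod_cast hc) (a := fun i => (a i : K))
    (e := fun i => (e i : K)) (fun i => by
      have := hae i
      split_ifs at this ⊢ <;> exact_mod_cast this)
    (by
      rw [← Int.cast_pow, ← hdet, Int.cast_det]
      rfl)
    (by exact_mod_cast he) (conjSum ψ x) (conjSum ψ y) (conjSum ψ w)
  rw [inducedMatrix_perturbedCoeff, h, circulantPairing_conjSum, circulantPairing_conjSum,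
    perturbationForm, periodValue_sub, periodValue_mul, periodValue_mul, perturbationBase,
    periodValue_add]
  simp only [sum_conjSum]
  have hc2 : periodValue ψ (c ^ 2, 0, 0) = (c : K) ^ 2 := by simp [periodValue]
  rw [hc2]
  ring

/-! ### Realising all admissible periods. -/

/-- The period `t₀ + t₁ S + t₂ N` occurs as the determinant of the representation induced by a
generic character. -/
def IsAttainable (t₀ t₁ t₂ : ℤ) : Prop :=
  ∃ f : ZMod 6 → ZMod 13 → ℤ, ∀ ψ : AddChar (ZMod 13) ℂ,
    (inducedMatrix f ψ).det = t₀ + t₁ * squareSum ψ + t₂ * nonsquareSum ψ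

theorem IsAttainable.exists_groupDeterminant {t₀ t₁ t₂ : ℤ} (h : IsAttainable t₀ t₁ t₂) :
    ∃ F : MonoidAlgebra ℤ Z13Z6,
      groupDeterminant F = (t₀ + 6 * t₁ + 6 * t₂) * periodNorm t₀ t₁ t₂ ^ 6 := by
  obtain ⟨f, hf⟩ := h
  exact ⟨ofMonomialCoeff f, groupDeterminant_eq_of_det_inducedMatrix
    (by rwa [monomialCoeff_ofMonomialCoeff])⟩

/-- Multiplication by `Y ^ 3` changes the sign of the determinant. -/
theorem IsAttainable.neg {t₀ t₁ t₂ : ℤ} (h : IsAttainable t₀ t₁ t₂) :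
    IsAttainable (-t₀) (-t₁) (-t₂) := by
  obtain ⟨f, hf⟩ := h
  refine ⟨fun i => f (i - 3), fun ψ => ?_⟩
  have hsub : inducedMatrix (fun i => f (i - 3)) ψ =
      (inducedMatrix f ψ).submatrix id (Equiv.addRight (3 : ZMod 6)) := by
    ext l j
    simp only [inducedMatrix, Matrix.submatrix_apply, Matrix.of_apply, Equiv.coe_addRight, id_eq,
      sub_sub]
  -- Translation by 3 is a product of three transpositions.
  have hsign : Equiv.Perm.sign (Equiv.addRight (3 : ZMod 6)) = -1 := by decide +kernel
  rw [hsub, Matrix.det_permute', hf, hsign]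
  push_cast
  ring

/-- If the linear parts of three perturbations generate the lattice of periods whose augmentation
is divisible by `6 * c`, then all periods of augmentation congruent to `c ^ 2` modulo `6 * c`
occur as determinants. -/
theorem isAttainable_of_perturbationForm {c : ℤ} (hc : c ≠ 0) {a e : ZMod 6 → ℤ}
    (hae : ∀ i, ∑ j, a (i - j) * e j = if i = 0 then c ^ 2 else 0)
    (hdet : (Matrix.of fun l j : ZMod 6 => a (l - j)).det = c ^ 2) (he : ∑ i, e i = c)
    {x y w₁ w₂ w₃ : ZMod 13 → ℤ}
    (h₁ : perturbationForm c e x y w₁ = (0, c, -c))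
    (h₂ : perturbationForm c e x y w₂ = (-6 * c, c, 0))
    (h₃ : perturbationForm c e x y w₃ = (6 * c * c, 0, 0))
    {b : ℤ × ℤ × ℤ} (hb : perturbationBase c e x y = b)
    (hbc : 6 * c ∣ b.1 + 6 * b.2.1 + 6 * b.2.2 - c ^ 2)
    {t₀ t₁ t₂ : ℤ} (ht : 6 * c ∣ t₀ + 6 * t₁ + 6 * t₂ - c ^ 2) :
    IsAttainable t₀ t₁ t₂ := by
  obtain ⟨r, hr⟩ := dvd_sub ht hbc
  -- After division by c, `w₁` and `w₂` adjust t₂ and t₁ at augmentation zero, and `w₃` adds 6c to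
  -- the augmentation.
  refine ⟨perturbedCoeff a x y ((b.2.2 - t₂) • w₁ +
    (t₁ + t₂ - b.2.1 - b.2.2) • w₂ + r • w₃), fun ψ => ?_⟩
  have hcC : (c : ℂ) ≠ 0 := by exact_mod_cast hc
  have hrC : ((t₀ + 6 * t₁ + 6 * t₂ - c ^ 2 - (b.1 + 6 * b.2.1 + 6 * b.2.2 - c ^ 2) : ℤ) : ℂ) =
    ((6 * c * r : ℤ) : ℂ) := congrArg _ hr
  push_cast at hrC
  refine mul_left_cancel₀ hcC ?_
  rw [mul_det_perturbedCoeff hc hae hdet he, hb,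
    perturbationForm_add, perturbationForm_add, perturbationForm_smul, perturbationForm_smul,
    perturbationForm_smul, h₁, h₂, h₃]
  simp only [periodValue, Prod.smul_mk, Prod.mk_add_mk, smul_eq_mul]
  push_cast
  linear_combination (-(c : ℂ)) * hrC

theorem isAttainable_of_base_one {t₀ t₁ t₂ : ℤ}
    (h : 6 ∣ t₀ + 6 * t₁ + 6 * t₂ - 1) : IsAttainable t₀ t₁ t₂ :=
  isAttainable_of_perturbationForm (c := 1) (by norm_num)
    (a := ![1, 0, 0, 0, 0, 0]) (e := ![1, 0, 0, 0, 0, 0]) (by decide +kernel)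
    ((det_circulant_six _).trans (by decide +kernel)) (by decide +kernel)
    (x := ![0, 0, 0, 0, 0, 0, 0, 0, 0, 0, 0, 0, 0])
    (y := ![0, 0, 0, 0, 0, 0, 0, 0, 0, 0, 0, 0, 0])
    (w₁ := ![0, 1, -1, 0, 0, 0, 0, 0, 0, 0, 0, 0, 0])
    (w₂ := ![-1, 1, 0, 0, 0, 0, 0, 0, 0, 0, 0, 0, 0])
    (w₃ := ![1, 0, 0, 0, 0, 0, 0, 0, 0, 0, 0, 0, 0])
    (by decide +kernel) (by decide +kernel) (by decide +kernel)
    (b := (1, 0, 0)) (by decide +kernel)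
    (by norm_num) (by omega)

/-- With x = 0 the linear form is c² times the trace of w and misses (0, c, -c) once c > 1. Hence
the nonzero x and y here and for c = 3, 6. -/
theorem isAttainable_of_base_two {t₀ t₁ t₂ : ℤ}
    (h : 12 ∣ t₀ + 6 * t₁ + 6 * t₂ - 4) : IsAttainable t₀ t₁ t₂ :=
  isAttainable_of_perturbationForm (c := 2) (by norm_num)
    (a := ![0, 0, 1, 0, 1, 0]) (e := ![-2, 0, 2, 0, 2, 0]) (by decide +kernel)
    ((det_circulant_six _).trans (by decide +kernel)) (by decide +kernel)
    (x := ![0, 0, 0, 0, 0, 0, 0, 0, 0, 0, 0, 0, 1])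
    (y := ![0, 0, 1, 0, 0, 0, 0, 0, 0, 0, 0, 0, 0])
    (w₁ := ![0, 0, 0, 0, 0, -1, 0, 0, 0, 0, 1, 0, 0])
    (w₂ := ![0, -1, 0, 0, 0, 0, 0, 0, 0, 0, 1, 0, 0])
    (w₃ := ![0, 2, 0, 0, 0, 0, 0, 0, 0, 0, -1, 0, 0])
    (by decide +kernel) (by decide +kernel) (by decide +kernel)
    (b := (4, 0, 2)) (by decide +kernel)
    (by norm_num) (by omega)

theorem isAttainable_of_base_three {t₀ t₁ t₂ : ℤ}
    (h : 18 ∣ t₀ + 6 * t₁ + 6 * t₂ - 9) : IsAttainable t₀ t₁ t₂ :=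
  isAttainable_of_perturbationForm (c := 3) (by norm_num)
    (a := ![1, 0, 1, 0, 0, 1]) (e := ![5, 2, -1, -4, 2, -1]) (by decide +kernel)
    ((det_circulant_six _).trans (by decide +kernel)) (by decide +kernel)
    (x := ![0, 0, 0, 0, 0, 0, 0, 0, 0, 0, 0, 0, 1])
    (y := ![0, 0, 0, 0, 0, 0, 0, 0, 0, 0, 1, 1, 0])
    (w₁ := ![0, 0, 0, -1, -1, 0, 0, 2, 0, 0, 0, 0, 0])
    (w₂ := ![0, 0, 0, -1, -2, 0, 0, 3, 0, 0, 0, 0, 0])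
    (w₃ := ![0, 0, 0, -1, 2, 0, 0, 0, 0, 0, 0, 0, 0])
    (by decide +kernel) (by decide +kernel) (by decide +kernel)
    (b := (3, 7, 0)) (by decide +kernel)
    (by norm_num) (by omega)

theorem isAttainable_of_base_six {t₀ t₁ t₂ : ℤ}
    (h : 36 ∣ t₀ + 6 * t₁ + 6 * t₂) : IsAttainable t₀ t₁ t₂ :=
  isAttainable_of_perturbationForm (c := 6) (by norm_num)
    (a := ![2, 1, 1, 1, 1, 0]) (e := ![16, -14, -8, -2, 4, 10]) (by decide +kernel)
    ((det_circulant_six _).trans (by decide +kernel)) (by decide +kernel)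
    (x := ![0, 0, 0, 1, 0, 0, 0, 0, 0, 0, 0, -1, 0])
    (y := ![0, 0, 0, 0, -1, 1, 0, 0, 0, 0, 0, 0, 0])
    (w₁ := ![0, 0, 0, -1, 0, 1, 0, 0, 0, 0, 0, 1, -1])
    (w₂ := ![0, 0, 0, 0, 0, 0, 0, 0, 0, 0, 0, 1, -1])
    (w₃ := ![0, 0, 0, -7, 0, 8, 0, 0, 0, 0, 0, 1, -1])
    (by decide +kernel) (by decide +kernel) (by decide +kernel)
    (b := (60, 10, -14)) (by decide +kernel)
    (by norm_num) (by omega)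

/-- The admissible m are ±1 modulo 6, ±4 modulo 12, 9 modulo 18 and 0 modulo 36. -/
theorem isAttainable_of_dvd {t₀ t₁ t₂ m : ℤ} (hm : m = t₀ + 6 * t₁ + 6 * t₂)
    (h2 : Odd m ∨ (4 : ℤ) ∣ m) (h3 : ¬ (3 : ℤ) ∣ m ∨ (9 : ℤ) ∣ m) : IsAttainable t₀ t₁ t₂ := by
  rw [Int.odd_iff] at h2
  have hneg : IsAttainable (-t₀) (-t₁) (-t₂) → IsAttainable t₀ t₁ t₂ := fun h => by
    simpa using h.neg
  rcases h2 with h2 | h2 <;> rcases h3 with h3 | h3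
  · rcases (by omega : m % 6 = 1 ∨ m % 6 = 5) with h | h
    · exact isAttainable_of_base_one (by omega)
    · exact hneg (isAttainable_of_base_one (by omega))
  · exact isAttainable_of_base_three (by omega)
  · rcases (by omega : m % 12 = 4 ∨ m % 12 = 8) with h | h
    · exact isAttainable_of_base_two (by omega)
    · exact hneg (isAttainable_of_base_two (by omega))
  · exact isAttainable_of_base_six (by omega)

theorem mainTheorem7 :
    Set.range (fun F : MonoidAlgebra ℤ Z13Z6 => groupDeterminant F) =
      {D : ℤ | ∃ m α β : ℤ,
        (Odd m ∨ (4 : ℤ) ∣ m) ∧ (¬ (3 : ℤ) ∣ m ∨ (9 : ℤ) ∣ m) ∧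
        (D : ℚ) = (m : ℚ) *
          Algebra.norm ℚ
            ((m : QSqrt13) + 13 * (α : QSqrt13) + (1 / 2) * (13 + sqrt13) * (β : QSqrt13)) ^ 6} := by
  ext D
  constructor
  · rintro ⟨F, rfl⟩
    obtain ⟨t₀, t₁, t₂, hD, h2, h3⟩ := exists_groupDeterminant_eq F
    refine ⟨_, -t₁, t₁ - t₂, h2, h3, ?_⟩
    rw [norm_eq_periodNorm t₀ t₁ t₂ _ _ _ rfl rfl rfl]
    exact_mod_cast hD
  · rintro ⟨m, α, β, h2, h3, hD⟩
    have hm : m = (m + 12 * α + 6 * β) + 6 * (-α) + 6 * (-α - β) := by ring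
    rw [norm_eq_periodNorm (m + 12 * α + 6 * β) (-α) (-α - β) m α β hm (by ring) (by ring)] at hD
    obtain ⟨F, hF⟩ := (isAttainable_of_dvd hm h2 h3).exists_groupDeterminant
    rw [← hm] at hF
    exact ⟨F, hF.trans (by exact_mod_cast hD.symm)⟩
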